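/- Let $\mathbb{D}=\{z\in\mathbb{C}:|z|<1\}$. A function is univalent if it is analytic and injective in $\mathbb{D}$; let $\mathcal{A}$ be the class of univalent functions $f(z)=z+\sum_{n\ge1}a_{n+1}z^{n+1}$ in $\mathbb{D}$. For $\kappa\in\mathbb{C}\setminus\{0,-1,-2,\dots\}$ and $c\in\mathbb{C}$ put $$B_{\kappa,c}(f)(z)=z+\sum_{n\ge1}a_{n+1}\frac{(-c/4)^n}{(\kappa)_n}\frac{z^{n+1}}{n!},\qquad (\kappa)_n=\kappa(\kappa+1)\cdots(\kappa+n-1),$$ and regard $B_{\kappa,c}(f)(z)/z$ as extended to $z=0$ by its limit value $1$. For analytic $f,F$ in $\mathbb{D}$ write $f\prec F$ if $f=F\circ w$ in $\mathbb{D}$ for some $w$ analytic in $\mathbb{D}$ with $|w(z)|\le|z|$. Let $\mathcal{H}[1,1]$ be the class of analytic functions in $\mathbb{D}$ with value $1$ at $0$. Let $Q$ be the class of functions $f$ on $\mathbb{D}$ that extend to be analytic and injective on $\overline{\mathbb{D}}\setminus E(f)$, where $E(f)=\{\zeta\in\partial\mathbb{D}:\lim_{z\to\zeta,\,z\in\mathbb{D}}f(z)=\infty\}$,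 with $f'(\zeta)\ne0$ for $\zeta\in\partial\mathbb{D}\setminus E(f)$. For $\varphi:\mathbb{C}^2\to\mathbb{C}$ and $h$ analytic in $\mathbb{D}$, a solution of the superordination $h(z)\prec\varphi(P(z),zP'(z))$ is a univalent $P$ such that $z\mapsto\varphi(P(z),zP'(z))$ is univalent and the superordination holds. A subordinant is an analytic $q$ in $\mathbb{D}$ with $q\prec P$ for every solution $P$; a best subordinant is a univalent subordinant $\tilde q$ with $q\prec\tilde q$ for every subordinant $q$. **Theorem.** Let $f,g\in\mathcal{A}$, $p,b\in\mathbb{R}$ with $\kappa=p+\frac{b+1}{2}>-1$, $c\in\mathbb{C}$ with $c\neq0$, and $\lambda\in[0,1)$. Put $$\Phi(z)=(1-\lambda)\frac{B_{\kappa+1,c}(g)(z)}{z}+\lambda\frac{B_{\kappa+2,c}(g)(z)}{z},$$ $$\gamma_{\lambda,\kappa}=\frac{(1-\lambda)^2+(\kappa+1)^2-\sqrt{(1-\lambda)^4+(\kappa+1)^4}}{4(1-\lambda)(\kappa+1)}.$$ Suppose that $\Phi'(z)\ne0$ and $$\operatorname{Re}\left(\frac{z\Phi''(z)}{\Phi'(z)}+1\right)>-\gamma_{\lambda,\kappa}\qquad\text{for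 all } z\in\mathbb{D},$$ that $$\Psi(z)=(1-\lambda)\frac{B_{\kappa+1,c}(f)(z)}{z}+\lambda\frac{B_{\kappa+2,c}(f)(z)}{z}$$ is univalent in $\mathbb{D}$, and that $z\mapsto B_{\kappa+2,c}(f)(z)/z$ belongs to $\mathcal{H}[1,1]\cap Q$. Then $\Phi\prec\Psi$ implies $$\frac{B_{\kappa+2,c}(g)(z)}{z}\prec\frac{B_{\kappa+2,c}(f)(z)}{z}.$$ Moreover, the function $z\mapsto B_{\kappa+2,c}(g)(z)/z$ is the best subordinant of the differential superordination $$\Phi(z)\prec P(z)+\frac{1-\lambda}{\kappa+1}\,zP'(z).$$ -/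

import Mathlib

namespace BesselSubord

open Metric Set Filter Topology

noncomputable section

/-- Analytic and injective on the open unit disk. -/
def Univalent (f : ℂ → ℂ) : Prop :=
  AnalyticOnNhd ℂ f (ball 0 1) ∧ InjOn f (ball 0 1)

/-- The class `𝒜` of normalized univalent functions `f(z) = z + a₂ z² + ...`. -/
def ClassA (f : ℂ → ℂ) : Prop :=
  Univalent f ∧ f 0 = 0 ∧ deriv f 0 = 1

/-- The `n`-th Taylor coefficient of `f` at the origin. -/
def taylorCoeff (f : ℂ → ℂ) (n : ℕ) : ℂ :=
  iteratedDeriv n f 0 / (n.factorial : ℂ)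

/-- The class `ℋ[a,n]` of functions `a + aₙ zⁿ + aₙ₊₁ zⁿ⁺¹ + ...` analytic in the unit disk. -/
def ClassH (a : ℂ) (n : ℕ) (f : ℂ → ℂ) : Prop :=
  AnalyticOnNhd ℂ f (ball 0 1) ∧ f 0 = a ∧ ∀ k, 0 < k → k < n → taylorCoeff f k = 0

/-- `f ≺ F` in the unit disk: `f = F ∘ w` with `w` analytic and `|w(z)| ≤ |z|`. -/
def Subordinate (f F : ℂ → ℂ) : Prop :=
  ∃ w : ℂ → ℂ, AnalyticOnNhd ℂ w (ball 0 1) ∧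
    ∀ z ∈ ball (0 : ℂ) 1, ‖w z‖ ≤ ‖z‖ ∧ f z = F (w z)

/-- The boundary points `ζ` with `f(z) → ∞` as `z → ζ` inside the unit disk. -/
def exceptionalSet (f : ℂ → ℂ) : Set ℂ :=
  {ζ | ζ ∈ sphere (0 : ℂ) 1 ∧ Tendsto f (𝓝[ball 0 1] ζ) (Bornology.cobounded ℂ)}

/-- The class `Q`: the function `f` on the unit disk extends to a function that is analytic (on a
neighbourhood of) and injective on the closed disk minus the exceptional set, with nonvanishing
derivative on the remaining part of the circle. -/
def ClassQ (f : ℂ → ℂ) : Prop :=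
  ∃ F : ℂ → ℂ, EqOn F f (ball 0 1) ∧
    AnalyticOnNhd ℂ F (closedBall 0 1 \ exceptionalSet f) ∧
    InjOn F (closedBall 0 1 \ exceptionalSet f) ∧
    ∀ ζ ∈ sphere (0 : ℂ) 1 \ exceptionalSet f, deriv F ζ ≠ 0

/-- `p` is a solution of the first-order differential superordination `h ≺ φ(p(z), z p'(z))`. -/
def IsSolution (φ : ℂ → ℂ → ℂ) (h p : ℂ → ℂ) : Prop :=
  Univalent p ∧ Univalent (fun z => φ (p z) (z * deriv p z)) ∧
    Subordinate h (fun z => φ (p z) (z * deriv p z))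

/-- `q` is analytic and subordinate to every solution of `h ≺ φ(p(z), z p'(z))`. -/
def IsSubordinant (φ : ℂ → ℂ → ℂ) (h q : ℂ → ℂ) : Prop :=
  AnalyticOnNhd ℂ q (ball 0 1) ∧ ∀ p, IsSolution φ h p → Subordinate q p

/-- `q` is a univalent subordinant to which every subordinant is subordinate. -/
def IsBestSubordinant (φ : ℂ → ℂ → ℂ) (h q : ℂ → ℂ) : Prop :=
  Univalent q ∧ IsSubordinant φ h q ∧ ∀ r, IsSubordinant φ h r → Subordinate r q

/-- The operator `B_{κ,c}`: for `f(z) = z + ∑_{n ≥ 1} a_{n+1} z^{n+1}`,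
`B_{κ,c}(f)(z) = z + ∑_{n ≥ 1} a_{n+1} (-c/4)^n / ((κ)_n n!) z^{n+1}`. -/
def besselOp (κ c : ℂ) (f : ℂ → ℂ) (z : ℂ) : ℂ :=
  ∑' n : ℕ, taylorCoeff f (n + 1) *
    ((-c / 4) ^ n / ((ascPochhammer ℂ n).eval κ * (n.factorial : ℂ))) * z ^ (n + 1)

/-- The function `z ↦ B_{κ,c}(f)(z) / z`, with the removable singularity at `0` removed. -/
def besselQuot (κ c : ℂ) (f : ℂ → ℂ) : ℂ → ℂ :=
  dslope (besselOp κ c f) 0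

theorem besselOp_zero (κ c : ℂ) (f : ℂ → ℂ) : besselOp κ c f 0 = 0 := by
  simp [besselOp]

theorem besselQuot_of_ne (κ c : ℂ) (f : ℂ → ℂ) {z : ℂ} (hz : z ≠ 0) :
    besselQuot κ c f z = besselOp κ c f z / z := by
  simp [besselQuot, dslope_of_ne _ hz, slope_def_field, besselOp_zero]

/-- `z ↦ (1 - λ) B_{κ+1,c}(f)(z) / z + λ B_{κ+2,c}(f)(z) / z`. -/
def besselComb (lam κ : ℝ) (c : ℂ) (f : ℂ → ℂ) (z : ℂ) : ℂ :=
  (1 - (lam : ℂ)) * besselQuot ((κ : ℂ) + 1) c f z + (lam : ℂ) * besselQuot ((κ : ℂ) + 2) c f z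

/-- The constant `γ_{λ,κ}`. -/
def gammaConst (lam κ : ℝ) : ℝ :=
  ((1 - lam) ^ 2 + (κ + 1) ^ 2 - Real.sqrt ((1 - lam) ^ 4 + (κ + 1) ^ 4)) /
    (4 * (1 - lam) * (κ + 1))

end

end BesselSubord

/-!
Put `α = (1 - λ) / (κ + 1) > 0`, `q = B_{κ+2,c}(g)(z) / z` and `P = B_{κ+2,c}(f)(z) / z`. Comparing
Taylor coefficients gives `Φ = q + α z q'` and `Ψ = P + α z P'` (`besselComb_eq`), so the assertion
concerns the superordination `Φ ≺ P + α z P'`.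

*Convexity of `q`.* The constant `γ` satisfies `γ ≤ min (α / 2) (1 / (2 α))` (`gammaConst_bounds`).
With `Q = 1 + z q'' / q'` one has `z Φ'' / Φ' + 1 = Q + α z Q' / (1 + α Q)`. If `Re Q > 0` failed, then
at a first bad point `Q = iρ`, and Jack's lemma (`jack_lemma`) gives `z Q' = -m (1 + ρ²) / 2` with
`m ≥ 1`, which makes the real part of the right-hand side at most `-γ`. Hence `q` is convex
(`convexCond_of_re_gt`).

*The chain `q + s z q'`.* For a fixed value `w`, the solutions `v` of `q v + s v q'(v) = w` move with
`dv/ds = -v / (1 + s Q(v))`, so `‖v‖` decreases as `s` grows. Following one solution from `s` to `α`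
shows that the values of `q + s z q'` on `‖z‖ ≤ r` are values of `Φ` on the same disk
(`ConvexCond.exists_chain_eq`). Following two distinct solutions to `s = ∞`, where the equation becomes
`v q'(v) = 0`, shows that every `q + s z q'` is injective, in particular `q` and `Φ`
(`ConvexCond.injOn_chain`). Continuation is by the implicit function theorem, in the parameter
`τ = 1 / (1 + s)`, and no differential equation has to be solved.

*Subordination.* If `q ≺ P` failed, then for some `ρ < 1` the values of `q` would leave
`P (ball 0 ρ)` first at a point `q z₀ = P ζ₀` with `‖z₀‖ < ρ = ‖ζ₀‖`, and Jack's lemma for `P⁻¹ ∘ q`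
would give `z₀ q'(z₀) = m ζ₀ P'(ζ₀)` with `m ≥ 1`. Thus `Ψ ζ₀ = q z₀ + (α / m) z₀ q'(z₀)` is a value of
`Φ`, hence of `Ψ`, on `‖v‖ ≤ ‖z₀‖`, against the injectivity of `Ψ` (`ConvexCond.subordinate`). The
disks of radius `ρ < 1` make this work for every univalent `P`, whatever its boundary behaviour, as
the notion of subordinant requires. Since `q` and `Φ` are univalent, `q` is itself a solution, and so
the best subordinant (`ConvexCond.isBestSubordinant`).
-/

namespace BesselSubord

open Metric Set Filter Topology

/-! ### Univalent functions and their inverses -/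

theorem Univalent.nhds_le_map {P : ℂ → ℂ} (hP : Univalent P) {z₀ : ℂ} (hz₀ : z₀ ∈ ball (0 : ℂ) 1) :
    𝓝 (P z₀) ≤ map P (𝓝 z₀) := by
  refine ((hP.1 z₀ hz₀).eventually_constant_or_nhds_le_map_nhds).resolve_left fun h => ?_
  have h1 : ∀ᶠ z in 𝓝[≠] z₀, P z = P z₀ ∧ z ∈ ball (0 : ℂ) 1 ∧ z ≠ z₀ :=
    (h.filter_mono nhdsWithin_le_nhds).and
      (Eventually.and (mem_nhdsWithin_of_mem_nhds (isOpen_ball.mem_nhds hz₀)) self_mem_nhdsWithin)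
  obtain ⟨z, h2, h3, h4⟩ := h1.exists
  exact h4 (hP.2 h3 hz₀ h2)

/-- The inverse of a univalent function, defined on its image of the unit disk. -/
noncomputable def Univalent.inv (P : ℂ → ℂ) : ℂ → ℂ := Function.invFunOn P (ball (0 : ℂ) 1)

theorem Univalent.inv_apply {P : ℂ → ℂ} (hP : Univalent P) {z : ℂ} (hz : z ∈ ball (0 : ℂ) 1) :
    Univalent.inv P (P z) = z :=
  hP.2.leftInvOn_invFunOn hz

theorem Univalent.tendsto_inv {P : ℂ → ℂ} (hP : Univalent P) {z₀ : ℂ}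
    (hz₀ : z₀ ∈ ball (0 : ℂ) 1) : Tendsto (Univalent.inv P) (𝓝 (P z₀)) (𝓝 z₀) := by
  have h : Tendsto (Univalent.inv P) (map P (𝓝 z₀)) (𝓝 z₀) := by
    rw [tendsto_map'_iff]
    refine tendsto_id.congr' ?_
    filter_upwards [isOpen_ball.mem_nhds hz₀] with z hz
    exact (hP.inv_apply hz).symm
  exact h.mono_left (hP.nhds_le_map hz₀)

theorem Univalent.eventually_mem_image {P : ℂ → ℂ} (hP : Univalent P) {z₀ : ℂ}
    (hz₀ : z₀ ∈ ball (0 : ℂ) 1) {s : Set ℂ} (hs : s ∈ 𝓝 z₀) : ∀ᶠ y in 𝓝 (P z₀), y ∈ P '' s :=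
  hP.nhds_le_map hz₀ (image_mem_map hs)

theorem Univalent.hasDerivAt_inv {P : ℂ → ℂ} (hP : Univalent P) {z₀ : ℂ}
    (hz₀ : z₀ ∈ ball (0 : ℂ) 1) (hd : deriv P z₀ ≠ 0) :
    HasDerivAt (Univalent.inv P) (deriv P z₀)⁻¹ (P z₀) := by
  refine HasDerivAt.of_local_left_inverse (f := P) ?_ ?_ hd ?_
  · rw [ContinuousAt, hP.inv_apply hz₀]; exact hP.tendsto_inv hz₀
  · rw [hP.inv_apply hz₀]; exact (hP.1 z₀ hz₀).differentiableAt.hasDerivAt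
  · filter_upwards [hP.eventually_mem_image hz₀ (isOpen_ball.mem_nhds hz₀)]
    rintro _ ⟨z, hz, rfl⟩
    rw [hP.inv_apply hz]

/-- The zeros of `P'` are isolated, so the inverse is differentiable on a punctured neighbourhood
of every image point; being continuous there, it is analytic at the point itself. -/
theorem Univalent.analyticAt_inv {P : ℂ → ℂ} (hP : Univalent P) {z₀ : ℂ}
    (hz₀ : z₀ ∈ ball (0 : ℂ) 1) : AnalyticAt ℂ (Univalent.inv P) (P z₀) := by
  refine Complex.analyticAt_of_differentiable_on_punctured_nhds_of_continuousAt ?_ ?_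
  · have h0 : ∀ᶠ z in 𝓝[≠] z₀, deriv P z ≠ 0 := by
      refine ((hP.1 z₀ hz₀).deriv.eventually_eq_zero_or_eventually_ne_zero).resolve_left fun h => ?_
      -- a vanishing derivative would make `P` locally constant
      obtain ⟨ε, hε, hb⟩ := Metric.mem_nhds_iff.1 (h.and (isOpen_ball.mem_nhds hz₀))
      have hconst : ∀ z ∈ ball z₀ ε, P z = P z₀ := fun z hz =>
        isOpen_ball.is_const_of_deriv_eq_zero (convex_ball z₀ ε).isPreconnected
          (fun x hx => (hP.1 x (hb hx).2).differentiableAt.differentiableWithinAt)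
          (fun x hx => (hb hx).1) hz (mem_ball_self hε)
      have h1 : ∀ᶠ z in 𝓝[≠] z₀, z ∈ ball z₀ ε ∧ z ≠ z₀ :=
        Eventually.and (mem_nhdsWithin_of_mem_nhds (ball_mem_nhds z₀ hε)) self_mem_nhdsWithin
      obtain ⟨z, h2, h3⟩ := h1.exists
      exact h3 (hP.2 (hb h2).2 hz₀ (hconst z h2))
    rw [eventually_nhdsWithin_iff] at h0
    have h1 := hP.eventually_mem_image hz₀ (h0.and (isOpen_ball.mem_nhds hz₀))
    rw [eventually_nhdsWithin_iff]
    filter_upwards [h1]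
    rintro _ ⟨z, ⟨hz1, hz2⟩, rfl⟩ hne
    have hzz : z ≠ z₀ := by rintro rfl; exact hne rfl
    exact (hP.hasDerivAt_inv hz2 (hz1 hzz)).differentiableAt
  · rw [ContinuousAt, hP.inv_apply hz₀]; exact hP.tendsto_inv hz₀

theorem Univalent.deriv_ne_zero {P : ℂ → ℂ} (hP : Univalent P) {z₀ : ℂ}
    (hz₀ : z₀ ∈ ball (0 : ℂ) 1) : deriv P z₀ ≠ 0 := by
  intro h0
  have h1 : HasDerivAt (Univalent.inv P ∘ P) (deriv (Univalent.inv P) (P z₀) * deriv P z₀) z₀ :=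
    (hP.analyticAt_inv hz₀).differentiableAt.hasDerivAt.comp z₀
      (hP.1 z₀ hz₀).differentiableAt.hasDerivAt
  have h2 : HasDerivAt (Univalent.inv P ∘ P) 1 z₀ := by
    refine (hasDerivAt_id z₀).congr_of_eventuallyEq ?_
    filter_upwards [isOpen_ball.mem_nhds hz₀] with z hz
    exact hP.inv_apply hz
  have := h1.unique h2
  simp [h0] at this

/-! ### Jack's lemma -/

/-- The derivative of `w` in the direction `z₀ d`, measured against `w z₀`: growth of `‖w‖` at most
linear with rate `c` bounds the real part of the logarithmic derivative. -/
theorem re_logDeriv_mul_le {w : ℂ → ℂ} {z₀ d : ℂ} {c : ℝ} (hw : DifferentiableAt ℂ w z₀)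
    (hne : w z₀ ≠ 0)
    (h : ∀ᶠ t : ℝ in 𝓝[>] 0, ‖w (z₀ * (1 + t * d))‖ ≤ (1 + c * t) * ‖w z₀‖) :
    (z₀ * deriv w z₀ / w z₀ * d).re ≤ c := by
  have h1 : HasDerivAt (fun t : ℝ => z₀ * (1 + (t : ℂ) * d)) (z₀ * d) (0 : ℝ) := by
    have := (((Complex.ofRealCLM.hasDerivAt (x := (0 : ℝ))).mul_const d).const_add 1).const_mul z₀
    simpa using this
  have h2 : HasDerivAt (fun t : ℝ => w (z₀ * (1 + (t : ℂ) * d)) / w z₀)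
      (z₀ * deriv w z₀ / w z₀ * d) (0 : ℝ) := by
    have hw' : HasDerivAt w (deriv w z₀) (z₀ * (1 + ((0 : ℝ) : ℂ) * d)) := by
      simpa using hw.hasDerivAt
    convert! (hw'.comp (0 : ℝ) h1).div_const (w z₀) using 1
    ring
  have h3 : HasDerivAt (fun t : ℝ => (w (z₀ * (1 + (t : ℂ) * d)) / w z₀).re)
      (z₀ * deriv w z₀ / w z₀ * d).re (0 : ℝ) :=
    (Complex.reCLM.hasFDerivAt.comp_hasDerivAt (0 : ℝ) h2)
  have h4 := h3.tendsto_slope_zero_right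
  refine le_of_tendsto h4 ?_
  filter_upwards [h, self_mem_nhdsWithin] with t ht (htp : 0 < t)
  have hpos : 0 < ‖w z₀‖ := norm_pos_iff.2 hne
  have h5 : (w (z₀ * (1 + (t : ℂ) * d)) / w z₀).re ≤ 1 + c * t := by
    refine (Complex.re_le_norm _).trans ?_
    rw [norm_div, div_le_iff₀ hpos]
    exact ht
  simp only [zero_add, Complex.ofReal_zero, zero_mul, add_zero, mul_one, div_self hne,
    Complex.one_re, smul_eq_mul]
  rw [inv_mul_le_iff₀ htp]
  linarith

/-- **Jack's lemma**: if `w 0 = 0` and `‖w‖` attains its maximum over `‖z‖ ≤ ‖z₀‖` at `z₀`, then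
`z₀ w'(z₀) = m w(z₀)` for some real `m ≥ 1`. -/
theorem jack_lemma {w : ℂ → ℂ} {z₀ : ℂ} (hz₀ : z₀ ≠ 0) (hd : DifferentiableOn ℂ w (ball 0 ‖z₀‖))
    (hw : DifferentiableAt ℂ w z₀) (h0 : w 0 = 0) (hne : w z₀ ≠ 0)
    (hle : ∀ z ∈ ball (0 : ℂ) ‖z₀‖, ‖w z‖ ≤ ‖w z₀‖) :
    ∃ m : ℝ, 1 ≤ m ∧ z₀ * deriv w z₀ = m * w z₀ := by
  have hr : 0 < ‖z₀‖ := norm_pos_iff.2 hz₀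
  set D := z₀ * deriv w z₀ / w z₀ with hD
  -- the Schwarz lemma controls the radial direction
  have hrad : (D * (-1)).re ≤ -1 := by
    refine re_logDeriv_mul_le hw hne ?_
    have : Ioo (0 : ℝ) 1 ∈ 𝓝[>] (0 : ℝ) := Ioo_mem_nhdsGT one_pos
    filter_upwards [this] with t ht
    have hn : ‖z₀ * (1 + (t : ℂ) * (-1))‖ = ‖z₀‖ * (1 - t) := by
      have : (1 + (t : ℂ) * (-1)) = ((1 - t : ℝ) : ℂ) := by push_cast; ring
      rw [norm_mul, this, Complex.norm_real, Real.norm_of_nonneg (by linarith [ht.2])]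
    have hmem : z₀ * (1 + (t : ℂ) * (-1)) ∈ ball (0 : ℂ) ‖z₀‖ := by
      rw [mem_ball_zero_iff, hn]; nlinarith [ht.1]
    have := Complex.dist_le_div_mul_dist_of_mapsTo_ball (R₂ := ‖w z₀‖) hd
      (fun z hz => by simpa [h0] using hle z hz) hmem
    rw [h0, dist_zero_right, dist_zero_right, hn] at this
    refine this.trans (le_of_eq ?_)
    field_simp
    ring
  -- in the half plane of inward directions `‖w‖` cannot grow
  have hin : ∀ d : ℂ, d.re < 0 → (D * d).re ≤ 0 := by
    intro d hdre
    refine re_logDeriv_mul_le hw hne ?_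
    have hd0 : 0 < Complex.normSq d := Complex.normSq_pos.2 (by rintro rfl; simp at hdre)
    have : Ioo (0 : ℝ) (-2 * d.re / Complex.normSq d) ∈ 𝓝[>] (0 : ℝ) :=
      Ioo_mem_nhdsGT (div_pos (by linarith) hd0)
    filter_upwards [this] with t ht
    rw [zero_mul, add_zero, one_mul]
    refine hle _ ?_
    rw [mem_ball_zero_iff, norm_mul]
    have h1 : ‖1 + (t : ℂ) * d‖ ^ 2 < 1 := by
      rw [← Complex.normSq_eq_norm_sq]
      have h2 := (lt_div_iff₀ hd0).1 ht.2
      have h3 : Complex.normSq (1 + (t : ℂ) * d) = 1 + t * (2 * d.re + t * Complex.normSq d) := by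
        simp [Complex.normSq_apply]; ring
      rw [h3]
      nlinarith [ht.1]
    have h2 : ‖1 + (t : ℂ) * d‖ < 1 := by
      by_contra! h; nlinarith
    nlinarith
  -- directions `-ε ± i` with `ε → 0` force the logarithmic derivative to be real
  have him : D.im = 0 := by
    have key : ∀ ε : ℝ, 0 < ε → |D.im| ≤ ε * D.re := by
      intro ε hε
      have h1 := hin (-ε + Complex.I) (by simpa using hε)
      have h2 := hin (-ε - Complex.I) (by simpa using hε)
      simp at h1 h2
      rw [abs_le]; constructor <;> linarith
    by_contra hne'
    have hp : 0 < |D.im| := abs_pos.2 hne'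
    have hDre : 0 < D.re := by
      have := key 1 one_pos
      linarith
    have := key (|D.im| / (2 * D.re)) (by positivity)
    rw [div_mul_eq_mul_div, le_div_iff₀ (by positivity)] at this
    nlinarith
  refine ⟨D.re, by simpa using hrad, ?_⟩
  have : ((D.re : ℝ) : ℂ) = D := by
    apply Complex.ext <;> simp [him]
  rw [this, hD]
  field_simp

/-! ### The chain `q + s z q'` of a convex function -/

/-- The analytic characterization of convex functions in the unit disk: `q` is locally injective and
`Re (1 + z q''(z) / q'(z)) > 0`. -/
def ConvexCond (q : ℂ → ℂ) : Prop :=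
  AnalyticOnNhd ℂ q (ball 0 1) ∧ ∀ z ∈ ball (0 : ℂ) 1, deriv q z ≠ 0 ∧
    0 < (1 + z * deriv (deriv q) z / deriv q z).re

/-- For `τ = 1 / (1 + s)`, the zeros of `chainFun q w τ` are the solutions `v` of
`q v + s v q'(v) = w`. The value `τ = 0` stands for `s = ∞`. -/
noncomputable def chainFun (q : ℂ → ℂ) (w : ℂ) (τ : ℝ) (v : ℂ) : ℂ :=
  (τ : ℂ) * (q v - w) + (1 - (τ : ℂ)) * (v * deriv q v)

theorem chainFun_eq_zero_iff {q : ℂ → ℂ} {w v : ℂ} {s : ℝ} (hs : 0 ≤ s) :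
    chainFun q w (1 / (1 + s)) v = 0 ↔ q v + s * (v * deriv q v) = w := by
  have h : (1 + (s : ℂ)) ≠ 0 := by
    exact_mod_cast (by linarith : (1 + s) ≠ 0)
  have : chainFun q w (1 / (1 + s)) v = (q v + s * (v * deriv q v) - w) / (1 + s) := by
    rw [chainFun]; push_cast; field_simp; ring
  rw [this, div_eq_zero_iff, sub_eq_zero]
  simp [h]

theorem continuousOn_chainFun {q : ℂ → ℂ} (hq : AnalyticOnNhd ℂ q (ball 0 1)) (w : ℂ) :
    ContinuousOn (fun p : ℝ × ℂ => chainFun q w p.1 p.2) (univ ×ˢ ball (0 : ℂ) 1) := by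
  have h1 : ContinuousOn (fun p : ℝ × ℂ => q p.2) (univ ×ˢ ball (0 : ℂ) 1) :=
    hq.continuousOn.comp continuousOn_snd fun p hp => hp.2
  have h2 : ContinuousOn (fun p : ℝ × ℂ => deriv q p.2) (univ ×ˢ ball (0 : ℂ) 1) :=
    hq.deriv.continuousOn.comp continuousOn_snd fun p hp => hp.2
  have h3 : ContinuousOn (fun p : ℝ × ℂ => (p.1 : ℂ)) (univ ×ˢ ball (0 : ℂ) 1) :=
    (Complex.continuous_ofReal.comp continuous_fst).continuousOn
  exact (h3.mul (h1.sub continuousOn_const)).add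
    ((continuousOn_const.sub h3).mul (continuousOn_snd.mul h2))

theorem hasStrictFDerivAt_chainFun {q : ℂ → ℂ} (hq : AnalyticOnNhd ℂ q (ball 0 1)) (w : ℂ)
    (τ : ℝ) {v : ℂ} (hv : v ∈ ball (0 : ℂ) 1) :
    HasStrictFDerivAt (fun p : ℝ × ℂ => chainFun q w p.1 p.2)
      ((ContinuousLinearMap.fst ℝ ℝ ℂ).smulRight (q v - w - v * deriv q v) +
        (τ * deriv q v + (1 - τ) * (deriv q v + v * deriv (deriv q) v)) •
          ContinuousLinearMap.snd ℝ ℝ ℂ) (τ, v) := by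
  have hsnd : HasStrictFDerivAt (fun p : ℝ × ℂ => p.2) (ContinuousLinearMap.snd ℝ ℝ ℂ) (τ, v) :=
    hasStrictFDerivAt_snd
  have hfst : HasStrictFDerivAt (fun p : ℝ × ℂ => (p.1 : ℂ))
      (Complex.ofRealCLM.comp (ContinuousLinearMap.fst ℝ ℝ ℂ)) (τ, v) :=
    Complex.ofRealCLM.hasStrictFDerivAt.comp (τ, v) hasStrictFDerivAt_fst
  have h1 : HasStrictFDerivAt (fun p : ℝ × ℂ => q p.2) _ (τ, v) :=
    ((hq v hv).hasStrictDerivAt.hasStrictFDerivAt.restrictScalars ℝ).comp (τ, v) hsnd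
  have h2 : HasStrictFDerivAt (fun p : ℝ × ℂ => deriv q p.2) _ (τ, v) :=
    ((hq.deriv v hv).hasStrictDerivAt.hasStrictFDerivAt.restrictScalars ℝ).comp (τ, v) hsnd
  refine ((hfst.mul (h1.sub_const w)).add
    ((hfst.const_sub 1).mul (hsnd.mul h2))).congr_fderiv ?_
  refine ContinuousLinearMap.ext fun x => ?_
  simp
  ring

/-- Zeros of `chainFun q w` can be continued in `τ`, uniquely, because the derivative
`q' (τ + (1 - τ) Q)` in `v`, where `Q = 1 + v q'' / q'`, does not vanish. Along the continuation
`dv/dτ = v / (τ (τ + (1 - τ) Q))`, so that `‖v‖` does not increase as `τ` decreases. -/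
theorem ConvexCond.exists_continuation {q : ℂ → ℂ} (hq : ConvexCond q) {w v : ℂ} {τ : ℝ}
    (hτ : τ ∈ Icc (0 : ℝ) 1) (hv : v ∈ ball (0 : ℂ) 1) (h0 : chainFun q w τ v = 0) :
    ∃ ψ : ℝ → ℂ, Tendsto ψ (𝓝 τ) (𝓝 v) ∧ (∀ᶠ t in 𝓝 τ, chainFun q w t (ψ t) = 0) ∧
      (∀ᶠ p : ℝ × ℂ in 𝓝 (τ, v), chainFun q w p.1 p.2 = 0 → p.2 = ψ p.1) ∧
      (0 < τ → ∀ᶠ t in 𝓝[<] τ, ‖ψ t‖ ≤ ‖v‖) := by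
  obtain ⟨hd0, hre⟩ := hq.2 v hv
  set Q := 1 + v * deriv (deriv q) v / deriv q v with hQ
  set a := q v - w - v * deriv q v with ha
  set b := τ * deriv q v + (1 - τ) * (deriv q v + v * deriv (deriv q) v) with hb
  have hre' : 0 < ((τ : ℂ) + (1 - τ) * Q).re := by
    have : ((τ : ℂ) + (1 - τ) * Q).re = τ + (1 - τ) * Q.re := by simp
    rw [this]
    rcases hτ.1.eq_or_lt with h | h
    · rw [← h]; linarith
    · have := mul_nonneg (sub_nonneg.2 hτ.2) hre.le
      linarith
  have hQne : ((τ : ℂ) + (1 - τ) * Q) ≠ 0 := fun h => by simp [h] at hre'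
  have hbQ : b = deriv q v * ((τ : ℂ) + (1 - τ) * Q) := by
    rw [hb, hQ]; field_simp
  have hb0 : b ≠ 0 := by rw [hbQ]; exact mul_ne_zero hd0 hQne
  have hf := hasStrictFDerivAt_chainFun hq.1 w τ hv
  rw [← ha, ← hb] at hf
  have hinv : (((ContinuousLinearMap.fst ℝ ℝ ℂ).smulRight a +
      b • ContinuousLinearMap.snd ℝ ℝ ℂ) ∘L .inr ℝ ℝ ℂ).IsInvertible := by
    refine ContinuousLinearMap.IsInvertible.of_inverse
      (g := b⁻¹ • ContinuousLinearMap.id ℝ ℂ) ?_ ?_ <;>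
    · refine ContinuousLinearMap.ext fun x => ?_
      simp [hb0]
  have hψ0 := hf.tendsto_implicitFunctionOfProdDomain hinv
  have hψ1 := hf.eventually_apply_implicitFunctionOfProdDomain hinv
  have hψ2 := hf.eventually_apply_eq_iff_implicitFunctionOfProdDomain hinv
  have hψ3 := (hf.hasStrictFDerivAt_implicitFunctionOfProdDomain hinv).hasFDerivAt.differentiableAt
  set ψ := hf.implicitFunctionOfProdDomain hinv
  simp only [h0] at hψ0 hψ1 hψ2 hψ3
  have hψv : ψ τ = v := tendsto_nhds_unique hψ3.continuousAt.tendsto hψ0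
  refine ⟨ψ, hψ0, hψ1, ?_, ?_⟩
  · filter_upwards [hψ2] with p hp h using (hp.1 h).symm
  · intro hτ0
    by_cases hv0 : v = 0
    · -- the zero `v = 0` does not move
      have hw : q 0 = w := by
        have : (τ : ℂ) ≠ 0 := by exact_mod_cast hτ0.ne'
        rw [chainFun, hv0] at h0
        simpa [this, sub_eq_zero] using h0
      have ht : Tendsto (fun t : ℝ => (t, (0 : ℂ))) (𝓝 τ) (𝓝 (τ, v)) := by
        rw [hv0]; exact (Continuous.prodMk_left (0 : ℂ)).tendsto τ
      have := ht.eventually hψ2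
      filter_upwards [mem_nhdsWithin_of_mem_nhds this] with t ht'
      have : ψ t = 0 := ht'.1 (by simp [chainFun, hw])
      simp [this]
    · -- differentiate the implicit equation
      have hder := hψ3.hasDerivAt
      set ψ' := deriv ψ τ
      have hcomp : HasDerivAt (fun t => chainFun q w t (ψ t)) (a + b * ψ') τ := by
        have hp : HasDerivAt (fun t : ℝ => (t, ψ t)) ((1 : ℝ), ψ') τ :=
          (hasDerivAt_id τ).prodMk hder
        have hf' : HasFDerivAt (fun p : ℝ × ℂ => chainFun q w p.1 p.2) _ (τ, ψ τ) :=
          hψv.symm ▸ hf.hasFDerivAt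
        have := hf'.comp_hasDerivAt τ hp
        simpa using! this
      have hzero : a + b * ψ' = 0 :=
        hcomp.unique ((hasDerivAt_const τ (0 : ℂ)).congr_of_eventuallyEq hψ1)
      have hτc : (τ : ℂ) ≠ 0 := by exact_mod_cast hτ0.ne'
      have haq : (τ : ℂ) * a = -(v * deriv q v) := by
        rw [chainFun] at h0; rw [ha]; linear_combination h0
      have hψ' : ψ' = v * ((τ : ℂ) * ((τ : ℂ) + (1 - τ) * Q))⁻¹ := by
        rw [← div_eq_mul_inv, eq_div_iff (mul_ne_zero hτc hQne)]
        have : deriv q v * (ψ' * ((τ : ℂ) * ((τ : ℂ) + (1 - τ) * Q))) = deriv q v * v := by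
          rw [hbQ] at hzero
          linear_combination (τ : ℂ) * hzero - haq
        exact mul_left_cancel₀ hd0 this
      have hpos : 0 < inner ℝ v ψ' := by
        have h1 : inner ℝ v ψ' =
            Complex.normSq v * (((τ : ℂ) * ((τ : ℂ) + (1 - τ) * Q))⁻¹).re := by
          rw [hψ', Complex.inner, mul_comm v, mul_assoc, Complex.mul_conj, mul_comm,
            Complex.re_ofReal_mul]
        rw [h1, Complex.inv_re, Complex.re_ofReal_mul]
        have h2 := mul_ne_zero hτc hQne
        have := Complex.normSq_pos.2 h2
        have := Complex.normSq_pos.2 hv0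
        positivity
      have hsq : HasDerivAt (fun t => ‖ψ t‖ ^ 2) (2 * inner ℝ v ψ') τ := by
        have := hder.norm_sq
        rwa [hψv] at this
      have hs := (hasDerivAt_iff_tendsto_slope_left_right.1 hsq).1
      have hev := hs.eventually (lt_mem_nhds (show (0 : ℝ) < 2 * inner ℝ v ψ' by linarith))
      filter_upwards [hev, self_mem_nhdsWithin] with t ht (htτ : t < τ)
      rw [slope_def_field, hψv, div_pos_iff] at ht
      rcases ht with h | h
      · nlinarith [norm_nonneg (ψ t), norm_nonneg v]
      · nlinarith [norm_nonneg (ψ t), norm_nonneg v]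

/-- The images `{q v + s v q'(v) : ‖v‖ ≤ r}` increase with `s`. -/
theorem ConvexCond.exists_chain_eq {q : ℂ → ℂ} (hq : ConvexCond q) {z : ℂ}
    (hz : z ∈ ball (0 : ℂ) 1) {s α : ℝ} (hs : 0 ≤ s) (hsα : s ≤ α) :
    ∃ v, ‖v‖ ≤ ‖z‖ ∧ q v + α * (v * deriv q v) = q z + s * (z * deriv q z) := by
  set w := q z + s * (z * deriv q z) with hw
  have hα : 0 ≤ α := hs.trans hsα
  set a := 1 / (1 + α) with ha
  set b := 1 / (1 + s) with hb
  have ha0 : 0 < a := by positivity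
  have hab : a ≤ b := one_div_le_one_div_of_le (by linarith) (by linarith)
  have hb1 : b ≤ 1 := by rw [hb, div_le_one (by linarith)]; linarith
  set T : Set ℝ := {τ | ∃ v, ‖v‖ ≤ ‖z‖ ∧ chainFun q w τ v = 0} with hT
  have hsub : closedBall (0 : ℂ) ‖z‖ ⊆ ball 0 1 :=
    closedBall_subset_ball (by simpa using hz)
  have hclosed : IsClosed (T ∩ Icc a b) := by
    have hK : IsCompact ((Icc a b ×ˢ closedBall (0 : ℂ) ‖z‖) ∩
        (fun p : ℝ × ℂ => chainFun q w p.1 p.2) ⁻¹' {0}) := by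
      have hc := isCompact_Icc (a := a) (b := b) |>.prod (isCompact_closedBall (0 : ℂ) ‖z‖)
      refine hc.of_isClosed_subset ?_ inter_subset_left
      exact ((continuousOn_chainFun hq.1 w).mono
        (prod_mono (subset_univ _) hsub)).preimage_isClosed_of_isClosed hc.isClosed
          isClosed_singleton
    convert (hK.image continuous_fst).isClosed using 1
    ext τ
    simp only [hT, mem_inter_iff, mem_ofPred_eq, mem_image, mem_prod, mem_closedBall_zero_iff,
      mem_preimage, mem_singleton_iff, Prod.exists, exists_and_right, exists_eq_right]
    constructor
    · rintro ⟨⟨v, hv, h⟩, hτ⟩; exact ⟨v, ⟨hτ, hv⟩, h⟩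
    · rintro ⟨v, ⟨hτ, hv⟩, h⟩; exact ⟨⟨v, hv, h⟩, hτ⟩
  have hbT : b ∈ T := ⟨z, le_rfl, (chainFun_eq_zero_iff hs).2 hw.symm⟩
  have haT : a ∈ T := by
    refine hclosed.mem_of_ge_of_forall_exists_lt hbT hab ?_
    rintro τ ⟨⟨v, hv, h0⟩, hτ⟩
    obtain ⟨ψ, -, h2, -, h4⟩ := hq.exists_continuation
      ⟨(ha0.trans hτ.1).le, hτ.2.trans hb1⟩ (hsub (by simpa using hv)) h0
    have h5 := (h2.filter_mono nhdsWithin_le_nhds).and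
      ((h4 (ha0.trans hτ.1)).and (Ico_mem_nhdsLT hτ.1))
    obtain ⟨t, h6, h7, h8⟩ := h5.exists
    exact ⟨t, ⟨ψ t, h7.trans hv, h6⟩, h8⟩
  obtain ⟨v, hv, h⟩ := haT
  exact ⟨v, hv, (chainFun_eq_zero_iff hα).1 h⟩

/-- Each member `q + s z q'` of the chain is injective: two distinct solutions of
`q v + s v q'(v) = w` could be continued to `s = ∞`, where `v q'(v) = 0` has only the solution
`0`. -/
theorem ConvexCond.injOn_chain {q : ℂ → ℂ} (hq : ConvexCond q) {s : ℝ} (hs : 0 ≤ s) :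
    InjOn (fun z => q z + s * (z * deriv q z)) (ball 0 1) := by
  intro z hz z' hz' heq
  by_contra hne
  simp only at heq
  set w := q z + s * (z * deriv q z) with hw
  set b := 1 / (1 + s) with hb
  have hb0 : 0 ≤ b := by positivity
  have hb1 : b ≤ 1 := by rw [hb, div_le_one (by linarith)]; linarith
  set r := max ‖z‖ ‖z'‖ with hr
  have hsub : closedBall (0 : ℂ) r ⊆ ball 0 1 :=
    closedBall_subset_ball (max_lt (by simpa using hz) (by simpa using hz'))
  set T : Set ℝ := {τ | ∃ v u, v ≠ u ∧ (‖v‖ ≤ r ∧ chainFun q w τ v = 0) ∧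
    (‖u‖ ≤ r ∧ chainFun q w τ u = 0)} with hT
  set K : Set (ℝ × ℂ) := (Icc 0 b ×ˢ closedBall (0 : ℂ) r) ∩
    (fun p : ℝ × ℂ => chainFun q w p.1 p.2) ⁻¹' {0} with hKdef
  have hK : IsCompact K := by
    have hc := isCompact_Icc (a := 0) (b := b) |>.prod (isCompact_closedBall (0 : ℂ) r)
    refine hc.of_isClosed_subset ?_ inter_subset_left
    exact ((continuousOn_chainFun hq.1 w).mono
      (prod_mono (subset_univ _) hsub)).preimage_isClosed_of_isClosed hc.isClosed
        isClosed_singleton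
  have hclosed : IsClosed (T ∩ Icc 0 b) := by
    -- pairs of zeros over the same parameter; distinct zeros stay apart by local uniqueness
    set L : Set ((ℝ × ℂ) × (ℝ × ℂ)) := (K ×ˢ K) ∩ {p | p.1.1 = p.2.1} with hL
    have hLc : IsCompact L :=
      (hK.prod hK).inter_right (isClosed_eq (by fun_prop) (by fun_prop))
    set O : Set ((ℝ × ℂ) × (ℝ × ℂ)) := interior {p | p ∈ L → p.1.2 = p.2.2}
    convert ((hLc.diff (isOpen_interior : IsOpen O)).image
      (f := fun p => p.1.1) (by fun_prop)).isClosed using 1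
    ext τ
    constructor
    · rintro ⟨⟨v, u, hvu, ⟨hv, hv0⟩, hu, hu0⟩, hτ⟩
      have hmem : ((τ, v), (τ, u)) ∈ L :=
        ⟨⟨⟨⟨hτ, by simpa using hv⟩, hv0⟩, ⟨⟨hτ, by simpa using hu⟩, hu0⟩⟩, rfl⟩
      exact ⟨((τ, v), (τ, u)), ⟨hmem, fun h => hvu (interior_subset h hmem)⟩, rfl⟩
    · rintro ⟨⟨⟨τ₁, v⟩, ⟨τ₂, u⟩⟩, ⟨hmem, hnot⟩, rfl⟩
      obtain ⟨⟨⟨⟨hτ, hv⟩, hv0⟩, ⟨⟨hτ', hu⟩, hu0⟩⟩, hττ⟩ := hmem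
      simp only [mem_ofPred_eq] at hττ hτ hv hτ' hu
      subst hττ
      refine ⟨⟨v, u, ?_, ⟨by simpa using hv, hv0⟩, ⟨by simpa using hu, hu0⟩⟩, hτ⟩
      rintro rfl
      refine hnot (mem_interior_iff_mem_nhds.2 ?_)
      obtain ⟨ψ, -, -, h3, -⟩ := hq.exists_continuation
        ⟨hτ.1, hτ.2.trans hb1⟩ (hsub hv) hv0
      have h5 := h3.prod_mk h3
      rw [← nhds_prod_eq] at h5
      filter_upwards [h5] with p hp hpL
      rw [hp.1 hpL.1.1.2, hp.2 hpL.1.2.2, hpL.2]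
  have hbT : b ∈ T := ⟨z, z', hne, ⟨le_max_left _ _, (chainFun_eq_zero_iff hs).2 hw.symm⟩,
    ⟨le_max_right _ _, (chainFun_eq_zero_iff hs).2 heq.symm⟩⟩
  have h0T : (0 : ℝ) ∈ T := by
    refine hclosed.mem_of_ge_of_forall_exists_lt hbT hb0 ?_
    rintro τ ⟨⟨v, u, hvu, ⟨hv, hv0⟩, hu, hu0⟩, hτ⟩
    obtain ⟨ψ, h1, h2, -, h4⟩ := hq.exists_continuation
      ⟨hτ.1.le, hτ.2.trans hb1⟩ (hsub (by simpa using hv)) hv0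
    obtain ⟨χ, k1, k2, -, k4⟩ := hq.exists_continuation
      ⟨hτ.1.le, hτ.2.trans hb1⟩ (hsub (by simpa using hu)) hu0
    have hne' : ∀ᶠ t in 𝓝 τ, ψ t ≠ χ t :=
      (h1.prodMk_nhds k1).eventually ((isOpen_ne_fun continuous_fst continuous_snd).mem_nhds hvu)
    have h5 := ((h2.and (k2.and hne')).filter_mono nhdsWithin_le_nhds).and ((h4 hτ.1).and ((k4 hτ.1).and (Ico_mem_nhdsLT hτ.1)))
    obtain ⟨t, ⟨h6, h7, h8⟩, h9, h10, h11⟩ := h5.exists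
    exact ⟨t, ⟨ψ t, χ t, h8, ⟨h9.trans hv, h6⟩, ⟨h10.trans hu, h7⟩⟩, h11⟩
  obtain ⟨v, u, hvu, ⟨hv, hv0⟩, hu, hu0⟩ := h0T
  have hzero : ∀ x, ‖x‖ ≤ r → chainFun q w 0 x = 0 → x = 0 := by
    intro x hx hx0
    have := (hq.2 x (hsub (by simpa using hx))).1
    simpa [chainFun, this] using hx0
  exact hvu ((hzero v hv hv0).trans (hzero u hu hu0).symm)

/-! ### Convexity from a lower bound for the transformed function -/

theorem normSq_sub_eq_normSq_add_sub (a b : ℂ) :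
    Complex.normSq (b - a) = Complex.normSq (b + a) - 4 * (b * (starRingEnd ℂ) a).re := by
  simp [Complex.normSq_apply]; ring

theorem re_one_add_div {a N : ℂ} (ha : a ≠ 0) :
    (1 + N / a).re = ((a + N) * (starRingEnd ℂ) a).re * (Complex.normSq a)⁻¹ := by
  have h1 : (starRingEnd ℂ) a ≠ 0 := by simpa using ha
  rw [← Complex.re_mul_ofReal, Complex.ofReal_inv, ← Complex.mul_conj]
  congr 1
  field_simp

/-- The value of `z Φ''(z) / Φ'(z) + 1` at a point where `Q = 1 + z q''(z) / q'(z)` is imaginary,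
given the relation that Jack's lemma yields for `(Q - 1) / (Q + 1)`. Here `a = q'(z)`,
`N = z q''(z)`, `M = z² q'''(z)`. -/
theorem re_add_one_le_of_jack {a N M : ℂ} {α γ m : ℝ} (hα : 0 < α) (h1 : 2 * γ ≤ α)
    (h2 : 2 * α * γ ≤ 1) (hm : 1 ≤ m) (ha : a ≠ 0) (hre : (1 + N / a).re = 0)
    (hjack : 2 * a * (N + M) - 2 * N ^ 2 = m * (N * (2 * a + N))) :
    ((N + α * (2 * N + M)) / (a + α * (a + N)) + 1).re ≤ -γ := by
  set ρ := (1 + N / a).im with hρ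
  have hQ : 1 + N / a = ρ * Complex.I := by
    apply Complex.ext <;> simp [hre, hρ]
  have hN : N = a * (ρ * Complex.I - 1) := by
    rw [← hQ]; field_simp; ring
  have hden : (1 + α * (ρ * Complex.I) : ℂ) ≠ 0 := by
    intro h
    have := congrArg Complex.re h
    simp at this
  have hsq : (0 : ℝ) < 1 + α ^ 2 * ρ ^ 2 := by positivity
  have hden' : (1 + (α : ℂ) ^ 2 * (ρ : ℂ) ^ 2) ≠ 0 := by exact_mod_cast hsq.ne'
  have hI := Complex.I_sq
  have hM : M = a * (-(ρ ^ 2 : ℂ) + 1 - 2 * ρ * Complex.I - m / 2 * (1 + ρ ^ 2) -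
      (ρ * Complex.I - 1)) := by
    have h2a : (2 * a) ≠ 0 := mul_ne_zero two_ne_zero ha
    have h3 : a * (2 * a * M) = a * (2 * a * (a * (-(ρ ^ 2 : ℂ) + 1 - 2 * ρ * Complex.I -
        m / 2 * (1 + ρ ^ 2) - (ρ * Complex.I - 1)))) := by
      rw [hN] at hjack
      linear_combination a * hjack + a ^ 3 * ρ ^ 2 * (2 + m) * hI
    exact mul_left_cancel₀ h2a (mul_left_cancel₀ ha h3)
  have hval : (N + α * (2 * N + M)) / (a + α * (a + N)) + 1 =
      ((-(α * m / 2 * (1 + ρ ^ 2) / (1 + α ^ 2 * ρ ^ 2)) : ℝ) : ℂ) +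
      ((ρ + α * m / 2 * (1 + ρ ^ 2) * (α * ρ) / (1 + α ^ 2 * ρ ^ 2) : ℝ) : ℂ) * Complex.I := by
    have hd : a + α * (a + N) = a * (1 + α * (ρ * Complex.I)) := by rw [hN]; ring
    have hn : N + α * (2 * N + M) = a * ((ρ * Complex.I - 1) + α * (2 * (ρ * Complex.I - 1) +
        (-(ρ ^ 2 : ℂ) + 1 - 2 * ρ * Complex.I - m / 2 * (1 + ρ ^ 2) - (ρ * Complex.I - 1)))) := by
      rw [hM]; nth_rewrite 1 2 [hN]; ring
    rw [hd, hn, mul_div_mul_left _ _ ha]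
    rw [div_add_one hden, div_eq_iff hden]
    push_cast
    linear_combination α * m / 2 * (1 + ρ ^ 2) * inv_mul_cancel₀ hden' -
      (ρ ^ 2 * α + ρ ^ 2 * α ^ 3 * m * (1 + ρ ^ 2) / 2 * (1 + α ^ 2 * ρ ^ 2 : ℂ)⁻¹) * hI
  rw [hval, Complex.add_re, Complex.re_ofReal_mul, Complex.ofReal_re, Complex.I_re, mul_zero,
    add_zero, neg_le_neg_iff, le_div_iff₀ hsq]
  nlinarith [mul_nonneg hα.le (sq_nonneg ρ), mul_nonneg (sub_nonneg.2 hm) hα.le,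
    mul_nonneg (mul_nonneg (sub_nonneg.2 hm) hα.le) (sq_nonneg ρ)]

/-- If `Φ = q + α z q'` satisfies `Re (z Φ'' / Φ' + 1) > -γ` with `γ ≤ min (α / 2) (1 / (2 α))`, then
`q` is convex. With `Q = 1 + z q'' / q'`, consider a point of least modulus where the real part of
`q' + z q''` times the conjugate of `q'`, that is `‖q'‖² Re Q`, fails to be positive. Jack's lemma
for `(Q - 1) / (Q + 1) = z q'' / (2 q' + z q'')` contradicts the bound there; working with the
cleared form also excludes zeros of `q'`. -/
theorem convexCond_of_re_gt {q Φ : ℂ → ℂ} (hq : AnalyticOnNhd ℂ q (ball 0 1)) {α γ : ℝ}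
    (hα : 0 < α) (h1 : 2 * γ ≤ α) (h2 : 2 * α * γ ≤ 1)
    (hΦ : ∀ z ∈ ball (0 : ℂ) 1, Φ z = q z + α * (z * deriv q z))
    (hΦ' : ∀ z ∈ ball (0 : ℂ) 1, deriv Φ z ≠ 0)
    (hre : ∀ z ∈ ball (0 : ℂ) 1, -γ < (z * deriv (deriv Φ) z / deriv Φ z + 1).re) :
    ConvexCond q := by
  set a := deriv q with ha
  set a' := deriv a with ha'
  set a'' := deriv a' with ha''
  have haA : AnalyticOnNhd ℂ a (ball 0 1) := hq.deriv
  have haA' : AnalyticOnNhd ℂ a' (ball 0 1) := haA.deriv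
  have hd0 : ∀ z ∈ ball (0 : ℂ) 1, HasDerivAt q (a z) z := fun z hz =>
    (hq z hz).differentiableAt.hasDerivAt
  have hd1 : ∀ z ∈ ball (0 : ℂ) 1, HasDerivAt a (a' z) z := fun z hz =>
    (haA z hz).differentiableAt.hasDerivAt
  have hd2 : ∀ z ∈ ball (0 : ℂ) 1, HasDerivAt a' (a'' z) z := fun z hz =>
    (haA' z hz).differentiableAt.hasDerivAt
  have hΦ1 : ∀ z ∈ ball (0 : ℂ) 1, deriv Φ z = a z + α * (a z + z * a' z) := by
    intro z hz
    have h : HasDerivAt (fun z => q z + α * (z * a z)) (a z + α * (1 * a z + z * a' z)) z :=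
      (hd0 z hz).add (((hasDerivAt_id z).mul (hd1 z hz)).const_mul _)
    rw [one_mul] at h
    refine (h.congr_of_eventuallyEq ?_).deriv
    filter_upwards [isOpen_ball.mem_nhds hz] with y hy using hΦ y hy
  have hΦ2 : ∀ z ∈ ball (0 : ℂ) 1, deriv (deriv Φ) z = a' z + α * (2 * a' z + z * a'' z) := by
    intro z hz
    have h : HasDerivAt (fun z => a z + α * (a z + z * a' z))
        (a' z + α * (a' z + (1 * a' z + z * a'' z))) z :=
      (hd1 z hz).add (((hd1 z hz).add ((hasDerivAt_id z).mul (hd2 z hz))).const_mul _)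
    have heq : deriv Φ =ᶠ[𝓝 z] fun z => a z + α * (a z + z * a' z) := by
      filter_upwards [isOpen_ball.mem_nhds hz] with y hy using hΦ1 y hy
    rw [(h.congr_of_eventuallyEq heq).deriv]
    ring
  set R : ℂ → ℝ := fun z => ((a z + z * a' z) * (starRingEnd ℂ) (a z)).re with hR
  have hRc : ContinuousOn R (ball 0 1) := by
    refine Complex.continuous_re.comp_continuousOn ?_
    exact (haA.continuousOn.add (continuousOn_id.mul haA'.continuousOn)).mul
      (Complex.continuous_conj.comp_continuousOn haA.continuousOn)
  -- `‖(Q - 1) / (Q + 1)‖ < 1` is equivalent to `0 < R`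
  have hmod : ∀ z, Complex.normSq (z * a' z) = Complex.normSq (2 * a z + z * a' z) - 4 * R z := by
    intro z
    have := normSq_sub_eq_normSq_add_sub (a z) (a z + z * a' z)
    convert this using 2 <;> ring_nf
  suffices hpos : ∀ z ∈ ball (0 : ℂ) 1, 0 < R z by
    refine ⟨hq, fun z hz => ?_⟩
    have hz0 : a z ≠ 0 := by
      intro h
      have := hpos z hz
      simp [hR, h] at this
    refine ⟨hz0, ?_⟩
    rw [← ha, ← ha', re_one_add_div hz0]
    exact mul_pos (hpos z hz) (inv_pos.2 (Complex.normSq_pos.2 hz0))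
  by_contra! hbad
  obtain ⟨z₁, hz₁, hR₁⟩ := hbad
  -- a point of least modulus where the claim fails
  obtain ⟨z₀, ⟨hz₀b, hz₀R⟩, hz₀R', hmin⟩ : ∃ z₀, (z₀ ∈ ball (0 : ℂ) 1 ∧ R z₀ ≤ 0) ∧ z₀ ≠ 0 ∧
      ∀ z ∈ ball (0 : ℂ) ‖z₀‖, 0 < R z := by
    have hsub : closedBall (0 : ℂ) ‖z₁‖ ⊆ ball 0 1 :=
      closedBall_subset_ball (by simpa using hz₁)
    have hK : IsCompact (closedBall (0 : ℂ) ‖z₁‖ ∩ R ⁻¹' Iic 0) :=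
      (isCompact_closedBall (0 : ℂ) ‖z₁‖).of_isClosed_subset
        ((hRc.mono hsub).preimage_isClosed_of_isClosed isClosed_closedBall isClosed_Iic)
        inter_subset_left
    obtain ⟨z₀, hz₀, hmin⟩ := hK.exists_isMinOn ⟨z₁, by simp, hR₁⟩ continuous_norm.continuousOn
    refine ⟨z₀, ⟨hsub hz₀.1, hz₀.2⟩, ?_, fun z hz => ?_⟩
    · rintro rfl
      have h0 : (0 : ℂ) ∈ ball (0 : ℂ) 1 := by simp
      have ha0 : a 0 ≠ 0 := by
        intro h
        apply hΦ' 0 h0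
        rw [hΦ1 0 h0, h]; simp
      have := hz₀.2
      simp only [hR, mem_preimage, zero_mul, add_zero, Complex.mul_conj, Complex.ofReal_re,
        mem_Iic] at this
      exact absurd this (not_le.2 (Complex.normSq_pos.2 ha0))
    · by_contra! h
      rw [mem_ball_zero_iff] at hz
      have := hmin (a := z) ⟨by
        have := hz₀.1
        rw [mem_closedBall_zero_iff] at this ⊢
        exact hz.le.trans this, h⟩
      exact absurd hz (not_lt.2 this)
  have hr : 0 < ‖z₀‖ := norm_pos_iff.2 hz₀R'
  have hr1 : ‖z₀‖ < 1 := by simpa using hz₀b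
  have hballsub : ball (0 : ℂ) ‖z₀‖ ⊆ ball 0 1 := ball_subset_ball hr1.le
  have hR0 : R z₀ = 0 := by
    refine le_antisymm hz₀R ?_
    have hcl : z₀ ∈ closure (ball (0 : ℂ) ‖z₀‖) := by
      rw [closure_ball _ hr.ne']; simp
    have : (𝓝[ball (0 : ℂ) ‖z₀‖] z₀).NeBot := mem_closure_iff_nhdsWithin_neBot.1 hcl
    refine ge_of_tendsto ((hRc.continuousAt (isOpen_ball.mem_nhds hz₀b)).mono_left
      (nhdsWithin_le_nhds (s := ball (0 : ℂ) ‖z₀‖))) ?_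
    filter_upwards [self_mem_nhdsWithin] with z hz using (hmin z hz).le
  have hA0 : 2 * a z₀ + z₀ * a' z₀ ≠ 0 := by
    intro h
    have h3 := hmod z₀
    rw [h, hR0] at h3
    simp only [map_zero, mul_zero, sub_zero, Complex.normSq_eq_zero] at h3
    rw [h3, add_zero, mul_eq_zero, or_iff_right two_ne_zero] at h
    apply hΦ' z₀ hz₀b
    rw [hΦ1 z₀ hz₀b, h3, h]; simp
  have hA : ∀ z ∈ ball (0 : ℂ) ‖z₀‖, 2 * a z + z * a' z ≠ 0 := by
    intro z hz h
    have h3 := hmod z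
    rw [h, map_zero] at h3
    linarith [Complex.normSq_nonneg (z * a' z), hmin z hz]
  have hw : ∀ z ∈ ball (0 : ℂ) 1, 2 * a z + z * a' z ≠ 0 →
      HasDerivAt (fun z => z * a' z / (2 * a z + z * a' z))
        (((1 * a' z + z * a'' z) * (2 * a z + z * a' z) -
          z * a' z * (2 * a' z + (1 * a' z + z * a'' z))) / (2 * a z + z * a' z) ^ 2) z := by
    intro z hz hne
    have hn := (hasDerivAt_id z).mul (hd2 z hz)
    exact hn.div (((hd1 z hz).const_mul 2).add hn) hne
  have hnorm : ∀ z, 2 * a z + z * a' z ≠ 0 → ‖z * a' z / (2 * a z + z * a' z)‖ ^ 2 =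
      1 - 4 * R z / Complex.normSq (2 * a z + z * a' z) := by
    intro z hne
    have := (Complex.normSq_pos.2 hne).ne'
    rw [← Complex.normSq_eq_norm_sq, Complex.normSq_div, hmod z, sub_div, div_self this]
  have hw0 : ‖z₀ * a' z₀ / (2 * a z₀ + z₀ * a' z₀)‖ = 1 := by
    have := hnorm z₀ hA0
    rw [hR0] at this
    simp only [mul_zero, zero_div, sub_zero] at this
    exact (pow_eq_one_iff_of_nonneg (norm_nonneg _) two_ne_zero).1 this
  obtain ⟨m, hm, hjack⟩ := jack_lemma hz₀R'
    (fun z hz => (hw z (hballsub hz) (hA z hz)).differentiableAt.differentiableWithinAt)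
    (hw z₀ hz₀b hA0).differentiableAt (by simp)
    (norm_ne_zero_iff.1 (by rw [hw0]; exact one_ne_zero))
    (fun z hz => by
      rw [hw0]
      have h3 := hnorm z (hA z hz)
      have h4 : 0 < 4 * R z / Complex.normSq (2 * a z + z * a' z) :=
        div_pos (by linarith [hmin z hz]) (Complex.normSq_pos.2 (hA z hz))
      by_contra! h5
      nlinarith)
  rw [(hw z₀ hz₀b hA0).deriv] at hjack
  have hrel : 2 * a z₀ * (z₀ * a' z₀ + z₀ ^ 2 * a'' z₀) - 2 * (z₀ * a' z₀) ^ 2 =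
      m * (z₀ * a' z₀ * (2 * a z₀ + z₀ * a' z₀)) := by
    field_simp at hjack
    linear_combination z₀ * hjack
  -- if `q' z₀ = 0`, the relation reads `(2 + m) (z₀ q'' z₀)² = 0`
  have haz : a z₀ ≠ 0 := by
    intro h
    rw [h] at hrel hA0
    have h3 : ((2 + m : ℝ) : ℂ) * (z₀ * a' z₀) ^ 2 = 0 := by
      push_cast; linear_combination -hrel
    rw [mul_eq_zero, Complex.ofReal_eq_zero, pow_eq_zero_iff two_ne_zero] at h3
    rcases h3 with h3 | h3
    · linarith
    · apply hA0; rw [h3]; simp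
  have hQre : (1 + z₀ * a' z₀ / a z₀).re = 0 := by
    rw [re_one_add_div haz]
    change R z₀ * _ = 0
    rw [hR0, zero_mul]
  have hfin := re_add_one_le_of_jack hα h1 h2 hm haz hQre hrel
  have := hre z₀ hz₀b
  rw [hΦ1 z₀ hz₀b, hΦ2 z₀ hz₀b] at this
  refine absurd this (not_lt.2 (le_trans (le_of_eq ?_) hfin))
  congr 3
  ring

/-! ### Subordinants of the linear first-order superordination -/

theorem Subordinate.refl (f : ℂ → ℂ) : Subordinate f f :=
  ⟨id, analyticOnNhd_id, fun _ _ => ⟨le_rfl, rfl⟩⟩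

theorem Subordinate.apply_zero {f F : ℂ → ℂ} (h : Subordinate f F) : f 0 = F 0 := by
  obtain ⟨w, -, hw⟩ := h
  obtain ⟨h1, h2⟩ := hw 0 (by simp)
  rw [norm_zero, norm_le_zero_iff] at h1
  rw [h2, h1]

theorem Subordinate.congr {f F g G : ℂ → ℂ} (h : Subordinate f F) (hf : EqOn f g (ball 0 1))
    (hF : EqOn F G (ball 0 1)) : Subordinate g G := by
  obtain ⟨w, h1, h2⟩ := h
  refine ⟨w, h1, fun z hz => ⟨(h2 z hz).1, ?_⟩⟩
  have hwz : w z ∈ ball (0 : ℂ) 1 := by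
    rw [mem_ball_zero_iff] at hz ⊢
    exact (h2 z (by simpa using hz)).1.trans_lt hz
  rw [← hf hz, (h2 z hz).2, hF hwz]

theorem Univalent.isOpen_image {P : ℂ → ℂ} (hP : Univalent P) {s : Set ℂ} (hs : IsOpen s)
    (hsub : s ⊆ ball 0 1) : IsOpen (P '' s) := by
  rw [isOpen_iff_mem_nhds]
  rintro _ ⟨x, hx, rfl⟩
  exact hP.eventually_mem_image (hsub hx) (hs.mem_nhds hx)

/-- For a univalent majorant, subordination only requires that every disk `‖z‖ < ρ` is mapped into
the image of that disk. -/
theorem Univalent.subordinate_of_mapsTo {q P : ℂ → ℂ} (hq : AnalyticOnNhd ℂ q (ball 0 1))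
    (hP : Univalent P) (h : ∀ ρ < 1, ∀ z ∈ ball (0 : ℂ) ρ, q z ∈ P '' ball 0 ρ) :
    Subordinate q P := by
  have key : ∀ z ∈ ball (0 : ℂ) 1, ∃ x ∈ ball (0 : ℂ) 1, ‖x‖ ≤ ‖z‖ ∧ P x = q z := by
    intro z hz
    rw [mem_ball_zero_iff] at hz
    obtain ⟨ρ₀, hρ₀, hρ₀'⟩ := exists_between hz
    obtain ⟨x, hx, hxz⟩ := h ρ₀ hρ₀' z (by simpa using hρ₀)
    rw [mem_ball_zero_iff] at hx
    have hx1 : x ∈ ball (0 : ℂ) 1 := by simpa using hx.trans hρ₀'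
    refine ⟨x, hx1, le_of_forall_gt_imp_ge_of_dense fun ρ hρ => ?_, hxz⟩
    by_cases hρ1 : ρ < 1
    · obtain ⟨y, hy, hyz⟩ := h ρ hρ1 z (by simpa using hρ)
      rw [mem_ball_zero_iff] at hy
      rw [hP.2 hx1 (by simpa using hy.trans hρ1) (hxz.trans hyz.symm)]
      exact hy.le
    · rw [mem_ball_zero_iff] at hx1
      linarith
  refine ⟨fun z => Univalent.inv P (q z), fun z hz => ?_, fun z hz => ?_⟩
  · obtain ⟨x, hx, -, hxz⟩ := key z hz
    exact AnalyticAt.fun_comp (hxz ▸ hP.analyticAt_inv hx) (hq z hz)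
  · obtain ⟨x, hx, hle, hxz⟩ := key z hz
    simp only
    rw [← hxz, hP.inv_apply hx]
    exact ⟨hle, rfl⟩

/-- Let `q` be convex and `P`, `P + α z P'` univalent. If `q + α z q' ≺ P + α z P'` then `q ≺ P`.
Otherwise, for some `ρ < 1`, the values of `q` leave `P (ball 0 ρ)` first at `q z₀ = P ζ₀` with
`‖ζ₀‖ = ρ`, and `z₀ q'(z₀) = m ζ₀ P'(ζ₀)` with `m ≥ 1` by Jack's lemma. Then
`P ζ₀ + α ζ₀ P'(ζ₀) = q z₀ + (α / m) z₀ q'(z₀)` is a value of `q + α z q'` on `‖v‖ ≤ ‖z₀‖`, hence one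
of `P + α z P'` on the same disk, although `‖z₀‖ < ‖ζ₀‖`. -/
theorem ConvexCond.subordinate {q P : ℂ → ℂ} (hq : ConvexCond q) (hP : Univalent P) {α : ℝ}
    (hα : 0 < α) (hΨ : InjOn (fun z => P z + α * (z * deriv P z)) (ball 0 1))
    (hsub : Subordinate (fun z => q z + α * (z * deriv q z))
      (fun z => P z + α * (z * deriv P z))) : Subordinate q P := by
  have hq0 : q 0 = P 0 := by simpa using hsub.apply_zero
  refine hP.subordinate_of_mapsTo hq.1 fun ρ hρ1 z₁ hz₁ => ?_
  by_contra hbad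
  rw [mem_ball_zero_iff] at hz₁
  have hρ0 : 0 < ρ := (norm_nonneg _).trans_lt hz₁
  have hρsub : ball (0 : ℂ) ρ ⊆ ball 0 1 := ball_subset_ball hρ1.le
  set S := P '' ball (0 : ℂ) ρ with hS
  have hSo : IsOpen S := hP.isOpen_image isOpen_ball hρsub
  -- a point of least modulus whose `q`-value is outside `P (ball 0 ρ)`
  obtain ⟨z₀, hz₀le, hz₀S, hmin⟩ : ∃ z₀, ‖z₀‖ ≤ ‖z₁‖ ∧ q z₀ ∉ S ∧
      ∀ z ∈ ball (0 : ℂ) ‖z₀‖, q z ∈ S := by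
    have hsub1 : closedBall (0 : ℂ) ‖z₁‖ ⊆ ball 0 1 := closedBall_subset_ball (hz₁.trans hρ1)
    have hK : IsCompact (closedBall (0 : ℂ) ‖z₁‖ ∩ q ⁻¹' Sᶜ) :=
      (isCompact_closedBall (0 : ℂ) ‖z₁‖).of_isClosed_subset
        ((hq.1.continuousOn.mono hsub1).preimage_isClosed_of_isClosed isClosed_closedBall
          hSo.isClosed_compl) inter_subset_left
    obtain ⟨z₀, hz₀, hmin⟩ := hK.exists_isMinOn ⟨z₁, by simp, hbad⟩ continuous_norm.continuousOn
    have hle : ‖z₀‖ ≤ ‖z₁‖ := by simpa using hz₀.1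
    refine ⟨z₀, hle, hz₀.2, fun z hz => ?_⟩
    by_contra h
    rw [mem_ball_zero_iff] at hz
    have := hmin (a := z) ⟨by simpa using hz.le.trans hle, h⟩
    exact absurd hz (not_lt.2 this)
  have hz₀ne : z₀ ≠ 0 := by
    rintro rfl
    exact hz₀S ⟨0, by simpa using hρ0, hq0.symm⟩
  have hr : 0 < ‖z₀‖ := norm_pos_iff.2 hz₀ne
  have hz₀ρ : ‖z₀‖ < ρ := hz₀le.trans_lt hz₁
  have hz₀b : z₀ ∈ ball (0 : ℂ) 1 := by simpa using hz₀ρ.trans hρ1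
  have hrsub : ball (0 : ℂ) ‖z₀‖ ⊆ ball 0 1 := ball_subset_ball (hz₀ρ.trans hρ1).le
  obtain ⟨ζ₀, hζ₀, hζq⟩ : q z₀ ∈ P '' closedBall (0 : ℂ) ρ := by
    have hcl : z₀ ∈ closure (ball (0 : ℂ) ‖z₀‖) := by
      rw [closure_ball _ hr.ne']; simp
    have hne : (𝓝[ball (0 : ℂ) ‖z₀‖] z₀).NeBot := mem_closure_iff_nhdsWithin_neBot.1 hcl
    have hcomp : IsCompact (P '' closedBall (0 : ℂ) ρ) :=
      (isCompact_closedBall _ _).image_of_continuousOn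
        (hP.1.continuousOn.mono (closedBall_subset_ball hρ1))
    refine hcomp.isClosed.mem_of_tendsto ((hq.1 z₀ hz₀b).continuousAt.mono_left
      (nhdsWithin_le_nhds (s := ball (0 : ℂ) ‖z₀‖))) ?_
    filter_upwards [self_mem_nhdsWithin] with z hz
    exact image_mono ball_subset_closedBall (hmin z hz)
  rw [mem_closedBall_zero_iff] at hζ₀
  have hζρ : ‖ζ₀‖ = ρ := by
    refine le_antisymm hζ₀ (not_lt.1 fun h => hz₀S ⟨ζ₀, by simpa using h, hζq⟩)
  have hζb : ζ₀ ∈ ball (0 : ℂ) 1 := by simpa [hζρ] using hρ1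
  set w : ℂ → ℂ := fun z => Univalent.inv P (q z) with hw
  have hwz₀ : w z₀ = ζ₀ := by rw [hw]; simp only; rw [← hζq, hP.inv_apply hζb]
  have hwA : AnalyticAt ℂ w z₀ := AnalyticAt.fun_comp (hζq ▸ hP.analyticAt_inv hζb) (hq.1 z₀ hz₀b)
  have hwball : ∀ z ∈ ball (0 : ℂ) ‖z₀‖, AnalyticAt ℂ w z ∧ ‖w z‖ < ρ := by
    intro z hz
    obtain ⟨x, hx, hxz⟩ := hmin z hz
    refine ⟨AnalyticAt.fun_comp (hxz ▸ hP.analyticAt_inv (hρsub hx)) (hq.1 z (hrsub hz)), ?_⟩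
    have : w z = x := by rw [hw]; simp only; rw [← hxz, hP.inv_apply (hρsub hx)]
    rw [this]
    simpa using hx
  obtain ⟨m, hm, hjack⟩ := jack_lemma hz₀ne
    (fun z hz => (hwball z hz).1.differentiableAt.differentiableWithinAt) hwA.differentiableAt
    (by rw [hw]; simp only; rw [hq0, hP.inv_apply (by simp)])
    (by rw [hwz₀, ← norm_pos_iff, hζρ]; exact hρ0)
    (fun z hz => by rw [hwz₀, hζρ]; exact (hwball z hz).2.le)
  have hderiv : deriv q z₀ = deriv P ζ₀ * deriv w z₀ := by
    have h1 : HasDerivAt (fun z => P (w z)) (deriv P ζ₀ * deriv w z₀) z₀ := by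
      have hPd : HasDerivAt P (deriv P ζ₀) (w z₀) := by
        rw [hwz₀]; exact (hP.1 ζ₀ hζb).differentiableAt.hasDerivAt
      exact hPd.comp z₀ hwA.differentiableAt.hasDerivAt
    refine (h1.congr_of_eventuallyEq ?_).deriv
    have h2 : ∀ᶠ y in 𝓝 (q z₀), y ∈ P '' ball (0 : ℂ) 1 :=
      hζq ▸ hP.eventually_mem_image hζb (isOpen_ball.mem_nhds hζb)
    filter_upwards [(hq.1 z₀ hz₀b).continuousAt.eventually h2] with z hz
    obtain ⟨x, hx, hxz⟩ := hz
    rw [hw]; simp only; rw [← hxz, hP.inv_apply hx]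
  have hm0 : (0 : ℝ) < m := one_pos.trans_le hm
  have hmc : (m : ℂ) ≠ 0 := by exact_mod_cast hm0.ne'
  obtain ⟨v, hv, hveq⟩ := hq.exists_chain_eq hz₀b (s := α / m) (α := α) (by positivity)
    (div_le_self hα.le hm)
  have hval : q z₀ + ((α / m : ℝ) : ℂ) * (z₀ * deriv q z₀) = P ζ₀ + α * (ζ₀ * deriv P ζ₀) := by
    rw [hζq, hderiv]
    rw [hwz₀] at hjack
    push_cast
    field_simp
    linear_combination α * deriv P ζ₀ * hjack
  obtain ⟨u, -, hu⟩ := hsub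
  obtain ⟨hu1, hu2⟩ := hu v (by simpa using hv.trans_lt (hz₀ρ.trans hρ1))
  have hub : ‖u v‖ < ρ := (hu1.trans hv).trans_lt hz₀ρ
  have hEq : u v = ζ₀ := hΨ (by simpa using hub.trans hρ1) hζb
    (by simp only at hu2 ⊢; rw [← hu2, hveq, hval])
  rw [hEq, hζρ] at hub
  exact lt_irrefl _ hub

/-- A convex `q` is itself a solution of the superordination by `q + α z q'`, and is therefore its
best subordinant. -/
theorem ConvexCond.isBestSubordinant {q Φ : ℂ → ℂ} (hq : ConvexCond q) {α : ℝ} (hα : 0 < α)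
    (hΦ : EqOn Φ (fun z => q z + α * (z * deriv q z)) (ball 0 1)) :
    IsBestSubordinant (fun u v => u + α * v) Φ q := by
  have hqU : Univalent q := ⟨hq.1, by simpa using hq.injOn_chain le_rfl⟩
  refine ⟨hqU, ⟨hq.1, fun P hP => ?_⟩, fun r hr => hr.2 q ⟨hqU, ⟨?_, ?_⟩, ?_⟩⟩
  · exact hq.subordinate hP.1 hα hP.2.1.2 (hP.2.2.congr hΦ fun _ _ => rfl)
  · exact hq.1.add (analyticOnNhd_const.mul (analyticOnNhd_id.mul hq.1.deriv))
  · exact hq.injOn_chain hα.le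
  · exact (Subordinate.refl _).congr hΦ.symm fun _ _ => rfl

/-! ### Power series of the Bessel-type operator -/

/-- The coefficient of `z ^ n` in `B_{κ,c}(f)(z) / z`. -/
noncomputable def besselCoeff (κ c : ℂ) (f : ℂ → ℂ) (n : ℕ) : ℂ :=
  taylorCoeff f (n + 1) *
    ((-c / 4) ^ n / ((ascPochhammer ℂ n).eval κ * (n.factorial : ℂ)))

theorem ascPochhammer_eval_ofReal (n : ℕ) (k : ℝ) :
    (ascPochhammer ℂ n).eval (k : ℂ) = ((ascPochhammer ℝ n).eval k : ℝ) := by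
  induction n with
  | zero => simp
  | succ n ih => rw [ascPochhammer_succ_eval, ascPochhammer_succ_eval, ih]; push_cast; ring

theorem min_one_le_ascPochhammer_eval {k : ℝ} (hk : 0 < k) (n : ℕ) :
    min 1 k ≤ (ascPochhammer ℝ n).eval k := by
  induction n with
  | zero => simp
  | succ n ih =>
    rw [ascPochhammer_succ_eval]
    rcases Nat.eq_zero_or_pos n with rfl | hn
    · simp
    · have h1 : (1 : ℝ) ≤ n := by exact_mod_cast hn
      have h2 : 0 < min 1 k := lt_min one_pos hk
      nlinarith

theorem exists_norm_taylorCoeff_le {f : ℂ → ℂ} (hf : AnalyticOnNhd ℂ f (ball 0 1)) :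
    ∃ C, ∀ n, ‖taylorCoeff f n‖ ≤ C * 2 ^ n := by
  have h := Complex.hasSum_taylorSeries_on_ball (c := 0) (r := 1) (z := 1 / 2)
    hf.differentiableOn (by rw [mem_ball_zero_iff]; norm_num)
  obtain ⟨C, hC⟩ := h.summable.tendsto_atTop_zero.norm.bddAbove_range
  refine ⟨C, fun n => ?_⟩
  have h1 := hC ⟨n, rfl⟩
  simp only [sub_zero, smul_eq_mul, norm_mul, norm_inv, norm_pow, norm_div, norm_one] at h1
  rw [taylorCoeff, norm_div]
  have h2 : ‖(2 : ℂ)‖ = 2 := by norm_num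
  rw [h2, div_pow, one_pow] at h1
  have h3 : (0 : ℝ) < 2 ^ n := by positivity
  calc ‖iteratedDeriv n f 0‖ / ‖(n.factorial : ℂ)‖
      = (‖(n.factorial : ℂ)‖⁻¹ * (1 / 2 ^ n * ‖iteratedDeriv n f 0‖)) * 2 ^ n := by
        field_simp
    _ ≤ C * 2 ^ n := mul_le_mul_of_nonneg_right h1 h3.le

theorem summable_norm_besselCoeff {f : ℂ → ℂ} (hf : AnalyticOnNhd ℂ f (ball 0 1)) {k : ℝ}
    (hk : 0 < k) (c : ℂ) : Summable fun n => ‖besselCoeff k c f n‖ := by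
  obtain ⟨C, hC⟩ := exists_norm_taylorCoeff_le hf
  have h2 : 0 < min 1 k := lt_min one_pos hk
  refine Summable.of_nonneg_of_le (fun _ => norm_nonneg _) (fun n => ?_)
    ((Real.summable_pow_div_factorial (‖c‖ / 2)).mul_left (2 * C / min 1 k))
  have h1 := min_one_le_ascPochhammer_eval hk n
  have hfac : (0 : ℝ) < n.factorial := by exact_mod_cast n.factorial_pos
  rw [besselCoeff, norm_mul, norm_div, norm_mul, norm_pow, norm_div, norm_neg,
    ascPochhammer_eval_ofReal, Complex.norm_real, Real.norm_of_nonneg (h2.le.trans h1),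
    Complex.norm_natCast, show ‖(4 : ℂ)‖ = 4 by norm_num]
  have hCn := hC (n + 1)
  calc ‖taylorCoeff f (n + 1)‖ *
        ((‖c‖ / 4) ^ n / ((ascPochhammer ℝ n).eval k * n.factorial))
      ≤ (C * 2 ^ (n + 1)) * ((‖c‖ / 4) ^ n / (min 1 k * n.factorial)) := by
        have h3 := h2.trans_le h1
        gcongr
        exact (norm_nonneg _).trans hCn
    _ = 2 * C / min 1 k * ((‖c‖ / 2) ^ n / n.factorial) := by
        have : (‖c‖ / 2) ^ n = 2 ^ n * (‖c‖ / 4) ^ n := by rw [← mul_pow]; congr 1; ring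
        rw [this]; field_simp; ring

theorem norm_mul_pow_le {A : ℕ → ℂ} (n : ℕ) {z : ℂ} (hz : z ∈ ball (0 : ℂ) 1) :
    ‖A n * z ^ n‖ ≤ ‖A n‖ := by
  rw [norm_mul, norm_pow]
  rw [mem_ball_zero_iff] at hz
  exact mul_le_of_le_one_right (norm_nonneg _) (pow_le_one₀ (norm_nonneg _) hz.le)

theorem differentiableOn_tsum_mul_pow {A : ℕ → ℂ} (hA : Summable fun n => ‖A n‖) :
    DifferentiableOn ℂ (fun z => ∑' n, A n * z ^ n) (ball 0 1) :=
  Complex.differentiableOn_tsum_of_summable_norm hA (fun n => by fun_prop) isOpen_ball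
    fun n _ hz => norm_mul_pow_le n hz

theorem hasSum_mul_deriv_tsum {A : ℕ → ℂ} (hA : Summable fun n => ‖A n‖) {z : ℂ}
    (hz : z ∈ ball (0 : ℂ) 1) :
    HasSum (fun n : ℕ => n * (A n * z ^ n)) (z * deriv (fun z => ∑' n, A n * z ^ n) z) := by
  have h := (Complex.hasSum_deriv_of_summable_norm (F := fun n z => A n * z ^ n) hA
    (fun n => by fun_prop) isOpen_ball (fun n _ hz => norm_mul_pow_le n hz) hz).mul_left z
  refine h.congr_fun fun n => ?_
  rw [deriv_const_mul_field, deriv_pow_field]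
  cases n with
  | zero => simp
  | succ n => simp; ring

theorem besselOp_eq_mul_tsum (κ c : ℂ) (f : ℂ → ℂ) (z : ℂ) :
    besselOp κ c f z = z * ∑' n, besselCoeff κ c f n * z ^ n := by
  rw [besselOp, ← tsum_mul_left]
  refine tsum_congr fun n => ?_
  rw [besselCoeff, pow_succ]; ring

theorem besselQuot_eq_tsum {f : ℂ → ℂ} (hf : AnalyticOnNhd ℂ f (ball 0 1)) {k : ℝ} (hk : 0 < k)
    (c : ℂ) : besselQuot k c f = fun z => ∑' n, besselCoeff k c f n * z ^ n := by
  funext z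
  rcases eq_or_ne z 0 with rfl | hz
  · have hS := (differentiableOn_tsum_mul_pow (summable_norm_besselCoeff hf hk c)).differentiableAt
      (isOpen_ball.mem_nhds (mem_ball_self one_pos))
    have h := (hasDerivAt_id (0 : ℂ)).mul hS.hasDerivAt
    rw [besselQuot, dslope_same, funext (besselOp_eq_mul_tsum k c f)]
    refine h.deriv.trans ?_
    simp
  · rw [besselQuot_of_ne _ _ _ hz, besselOp_eq_mul_tsum, mul_div_cancel_left₀ _ hz]

theorem analyticOnNhd_besselQuot {f : ℂ → ℂ} (hf : AnalyticOnNhd ℂ f (ball 0 1)) {k : ℝ}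
    (hk : 0 < k) (c : ℂ) : AnalyticOnNhd ℂ (besselQuot k c f) (ball 0 1) := by
  rw [besselQuot_eq_tsum hf hk]
  exact (differentiableOn_tsum_mul_pow (summable_norm_besselCoeff hf hk c)).analyticOnNhd
    isOpen_ball

/-- The contiguous relation `(k)ₙ (k + n) = k (k + 1)ₙ` in terms of the coefficients. -/
theorem besselCoeff_eq_contiguous (f : ℂ → ℂ) {k : ℝ} (hk : 0 < k) (c : ℂ) (n : ℕ) :
    besselCoeff k c f n = (1 + n / k) * besselCoeff ((k + 1 : ℝ) : ℂ) c f n := by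
  have h1 : (ascPochhammer ℝ n).eval k * (k + n) = k * (ascPochhammer ℝ n).eval (k + 1) := by
    rw [← ascPochhammer_succ_eval, ascPochhammer_succ_left]
    simp
  have h2 : (((ascPochhammer ℝ n).eval k : ℝ) : ℂ) * (k + n) =
      k * ((ascPochhammer ℝ n).eval (k + 1) : ℝ) := by exact_mod_cast h1
  have p1 : (((ascPochhammer ℝ n).eval k : ℝ) : ℂ) ≠ 0 := by
    exact_mod_cast ((lt_min one_pos hk).trans_le (min_one_le_ascPochhammer_eval hk n)).ne'
  have p2 : (((ascPochhammer ℝ n).eval (k + 1) : ℝ) : ℂ) ≠ 0 := by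
    have hk1 : 0 < k + 1 := by linarith
    exact_mod_cast ((lt_min one_pos hk1).trans_le (min_one_le_ascPochhammer_eval hk1 n)).ne'
  have p3 : (k : ℂ) ≠ 0 := by exact_mod_cast hk.ne'
  have p5 : (((ascPochhammer ℝ n).eval k : ℝ) : ℂ)⁻¹ =
      (1 + n / k) * (((ascPochhammer ℝ n).eval (k + 1) : ℝ) : ℂ)⁻¹ := by
    field_simp
    linear_combination -h2
  rw [besselCoeff, besselCoeff, ascPochhammer_eval_ofReal, ascPochhammer_eval_ofReal,
    div_mul_eq_div_div, div_mul_eq_div_div, div_eq_mul_inv (_ ^ n), div_eq_mul_inv (_ ^ n), p5]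
  ring

/-- The differential relation between neighbouring parameters turns the combination defining `Φ`
and `Ψ` into `P + ((1 - λ) / (κ + 1)) z P'` with `P = B_{κ+2,c}(f)(z) / z`. -/
theorem besselComb_eq {f : ℂ → ℂ} (hf : AnalyticOnNhd ℂ f (ball 0 1)) {κ : ℝ} (hκ : -1 < κ)
    (lam : ℝ) (c : ℂ) : EqOn (besselComb lam κ c f)
      (fun z => besselQuot ((κ : ℂ) + 2) c f z +
        ((1 - lam) / (κ + 1) : ℝ) * (z * deriv (besselQuot ((κ : ℂ) + 2) c f) z))
      (ball 0 1) := by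
  intro z hz
  have hk1 : 0 < κ + 1 := by linarith
  have hk2 : 0 < κ + 1 + 1 := by linarith
  have e1 : (κ : ℂ) + 1 = ((κ + 1 : ℝ) : ℂ) := by push_cast; ring
  have e2 : (κ : ℂ) + 2 = ((κ + 1 + 1 : ℝ) : ℂ) := by push_cast; ring
  have hA := summable_norm_besselCoeff hf hk2 c
  have hs : HasSum (fun n => besselCoeff ((κ + 1 + 1 : ℝ) : ℂ) c f n * z ^ n)
      (besselQuot ((κ + 1 + 1 : ℝ) : ℂ) c f z) := by
    rw [besselQuot_eq_tsum hf hk2]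
    exact (hA.of_nonneg_of_le (fun _ => norm_nonneg _)
      fun n => norm_mul_pow_le n hz).of_norm.hasSum
  have hd := hasSum_mul_deriv_tsum hA hz
  rw [← besselQuot_eq_tsum hf hk2] at hd
  have hq : besselQuot ((κ + 1 : ℝ) : ℂ) c f z = besselQuot ((κ + 1 + 1 : ℝ) : ℂ) c f z +
      ((κ + 1 : ℝ) : ℂ)⁻¹ * (z * deriv (besselQuot ((κ + 1 + 1 : ℝ) : ℂ) c f) z) := by
    rw [besselQuot_eq_tsum hf hk1]
    refine ((hs.add (hd.mul_left _)).congr_fun ?_).tsum_eq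
    intro n
    rw [besselCoeff_eq_contiguous f hk1]
    ring
  simp only [besselComb]
  rw [e1, e2, hq]
  push_cast
  ring

theorem gammaConst_bounds {lam κ : ℝ} (hκ : -1 < κ) (hlam : lam < 1) :
    2 * gammaConst lam κ ≤ (1 - lam) / (κ + 1) ∧
      2 * ((1 - lam) / (κ + 1)) * gammaConst lam κ ≤ 1 := by
  have hA : 0 < 1 - lam := by linarith
  have hB : 0 < κ + 1 := by linarith
  rw [gammaConst]
  set A := 1 - lam
  set B := κ + 1
  have h1 : A ^ 2 ≤ √(A ^ 4 + B ^ 4) :=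
    Real.le_sqrt_of_sq_le (by nlinarith [sq_nonneg (B ^ 2)])
  have h2 : B ^ 2 ≤ √(A ^ 4 + B ^ 4) :=
    Real.le_sqrt_of_sq_le (by nlinarith [sq_nonneg (A ^ 2)])
  have hAA := sq_nonneg A
  have hBB := sq_nonneg B
  constructor
  · rw [← mul_div_assoc, div_le_div_iff₀ (by positivity) hB]
    nlinarith [mul_le_mul_of_nonneg_right (show A ^ 2 + B ^ 2 - √(A ^ 4 + B ^ 4) ≤ 2 * A ^ 2 by
      linarith) hB.le]
  · have : 2 * (A / B) * ((A ^ 2 + B ^ 2 - √(A ^ 4 + B ^ 4)) / (4 * A * B)) =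
        (A ^ 2 + B ^ 2 - √(A ^ 4 + B ^ 4)) / (2 * B ^ 2) := by
      field_simp; ring
    rw [this, div_le_one (by positivity)]
    linarith

end BesselSubord

theorem mainTheorem2
    (f g : ℂ → ℂ) (hf : BesselSubord.ClassA f) (hg : BesselSubord.ClassA g)
    (p b κ : ℝ) (hκ : κ = p + (b + 1) / 2) (hκ1 : -1 < κ)
    (c : ℂ) (hc : c ≠ 0) (lam : ℝ) (hlam0 : 0 ≤ lam) (hlam1 : lam < 1)
    (Φ : ℂ → ℂ) (hΦ : Φ = BesselSubord.besselComb lam κ c g)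
    (hΦ' : ∀ z ∈ Metric.ball (0 : ℂ) 1, deriv Φ z ≠ 0)
    (hre : ∀ z ∈ Metric.ball (0 : ℂ) 1,
      -BesselSubord.gammaConst lam κ < (z * deriv (deriv Φ) z / deriv Φ z + 1).re)
    (huniv : BesselSubord.Univalent (BesselSubord.besselComb lam κ c f))
    (hH : BesselSubord.ClassH 1 1 (BesselSubord.besselQuot ((κ : ℂ) + 2) c f))
    (hQ : BesselSubord.ClassQ (BesselSubord.besselQuot ((κ : ℂ) + 2) c f)) :
    (BesselSubord.Subordinate Φ (BesselSubord.besselComb lam κ c f) →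
      BesselSubord.Subordinate (BesselSubord.besselQuot ((κ : ℂ) + 2) c g)
        (BesselSubord.besselQuot ((κ : ℂ) + 2) c f)) ∧
    BesselSubord.IsBestSubordinant
      (fun u v => u + ((1 - (lam : ℂ)) / ((κ : ℂ) + 1)) * v) Φ
      (BesselSubord.besselQuot ((κ : ℂ) + 2) c g) := by
  have hα : 0 < (1 - lam) / (κ + 1) := div_pos (by linarith) (by linarith)
  obtain ⟨hγ1, hγ2⟩ := BesselSubord.gammaConst_bounds hκ1 hlam1
  have hΦq := BesselSubord.besselComb_eq hg.1.1 hκ1 lam c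
  have hΨP := BesselSubord.besselComb_eq hf.1.1 hκ1 lam c
  rw [← hΦ] at hΦq
  have hqA : AnalyticOnNhd ℂ (BesselSubord.besselQuot ((κ : ℂ) + 2) c g) (Metric.ball 0 1) := by
    have := BesselSubord.analyticOnNhd_besselQuot hg.1.1 (k := κ + 2) (by linarith) c
    push_cast at this
    exact this
  have hq := BesselSubord.convexCond_of_re_gt hqA hα hγ1 hγ2 hΦq hΦ' hre
  have hP : BesselSubord.Univalent (BesselSubord.besselQuot ((κ : ℂ) + 2) c f) := by
    obtain ⟨F, hF, -, hinj, -⟩ := hQ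
    refine ⟨hH.1, (hinj.mono ?_).congr hF⟩
    -- the exceptional set lies on the circle
    refine fun z hz => ⟨Metric.ball_subset_closedBall hz, fun hE => ?_⟩
    exact (Metric.mem_ball.1 hz).ne (Metric.mem_sphere.1 hE.1)
  constructor
  · intro h
    exact hq.subordinate hP hα (huniv.2.congr hΨP) (h.congr hΦq hΨP)
  · have := hq.isBestSubordinant hα hΦq
    push_cast at this
    exact this
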